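/- Let $A(\rho)=A_0+\sum_{i=1}^p\rho_iA_i$ with $A_0,\dots,A_p\in\mathbb{R}^{n\times n}$, let $B\in\mathbb{R}^{n\times m}$, $Q\succeq 0$, $R\succ 0$, $\alpha>0$, and let $\mathcal{P}\subset\mathbb{R}^p$ be a convex and compact polytope. Let $\mathcal{C}=\prod_{i=1}^{mn}[\underline{C}_i,\overline{C}_i]\subset\mathbb{R}^{mn}$, let $g:\mathbb{R}^{mn}\to\mathbb{R}^{2mn}$, $g(k)=(k_1-\underline{C}_1,\dots,k_{mn}-\underline{C}_{mn},\overline{C}_1-k_1,\dots,\overline{C}_{mn}-k_{mn})$, with Jacobian matrix $J_g$, and put $$F=2\operatorname{diag}(g)+J_gJ_g^\top,\qquad M=I-J_g^\top F^{-1}J_g .$$ For $K\in\mathbb{R}^{m\times n}$ and $\rho\in\mathcal{P}$ write $A_K=A(\rho)-BK$, let $P_K$ and $Y_K$ be the solutions of $A_K^\top P_K+P_KA_K+Q+K^\top RK=0$ and $A_KY_K+Y_KA_K^\top+I=0$, and let $$\nabla_{\mathcal{C}}f_K(\rho)=M(\operatorname{vec}K)\,\operatorname{vec}\bigl(2(RK-B^\top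 P_K)Y_K\bigr).$$ Let $\mathcal{K}_{\mathcal{P}}$ be the set of all $K\in\mathbb{R}^{m\times n}$ such that, for every $\rho\in\mathcal{P}$, all eigenvalues of $A(\rho)-BK$ have negative real part. Assume $\mathcal{C}\subseteq\operatorname{vec}(\mathcal{K}_{\mathcal{P}})$. Then there is a convex and compact polytope $\mathcal{V}\subset\mathbb{R}^{mn}$ with $0\in\mathcal{V}$ such that the following holds for every $\rho:[0,\infty)\to\mathcal{P}$ that is continuous except at finitely many times. For every initial gain $K_0$ with $\operatorname{vec}(K_0)\in\operatorname{int}(\mathcal{C})$, the controller equation $$\operatorname{vec}(\dot K)=-\alpha\nabla_{\mathcal{C}}f_K(\rho(t)),\qquad K(0)=K_0,$$ understood in the Carathéodory sense $$\operatorname{vec}(K(t))=\operatorname{vec}(K_0)-\alpha\int_0^t\nabla_{\mathcal{C}}f_{K(\tau)}(\rho(\tau))\,\mathrm{d}\tau ,$$ has a solution on $[0,\infty)$, and every solution on a subinterval of $[0,\infty)$ containing $0$ agrees with it there. This trajectory satisfies $\operatorname{vec}(K(t))\in\operatorname{int}(\mathcal{C})$ for all $t\ge 0$, it is continuous on $[0,\infty)$,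 and at every time $t\ge 0$ at which $\rho$ is continuous it is differentiable (from the right if $t=0$) with $\operatorname{vec}(\dot K(t))\in\mathcal{V}$. -/

import Mathlib

open Set MeasureTheory
open scoped Matrix

noncomputable section

namespace ProjectedLQR

/-- A convex compact polytope: the convex hull of finitely many points. -/
def IsPolytope {ι : Type*} (S : Set (ι → ℝ)) : Prop :=
  ∃ F : Set (ι → ℝ), F.Finite ∧ S = convexHull ℝ F

/-- The times in `[0, ∞)` at which the trajectory `x` is discontinuous. -/
def discontinuities {E : Type*} [TopologicalSpace E] (x : ℝ → E) : Set ℝ :=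
  {t | 0 ≤ t ∧ ¬ ContinuousWithinAt x (Ici 0) t}

/-- The piecewise continuous trajectories `[0, ∞) → S` with finitely many discontinuities.
Trajectories are functions on `ℝ` of which only the restriction to `[0, ∞)` matters. One-sided
limits at the discontinuities are not required to exist. -/
def piecewiseContinuousTrajectories {E : Type*} [TopologicalSpace E] (S : Set E) :
    Set (ℝ → E) :=
  {x | (∀ t, 0 ≤ t → x t ∈ S) ∧ (discontinuities x).Finite}

/-- The continuous trajectories `[0, ∞) → S` that are differentiable with derivative in `V` at all
times outside `D` (one-sided derivative at time `0`). -/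
def rateBoundedTrajectories {ι : Type*} [Fintype ι] (S V : Set (ι → ℝ)) (D : Set ℝ) :
    Set (ℝ → ι → ℝ) :=
  {x | (∀ t, 0 ≤ t → x t ∈ S) ∧ ContinuousOn x (Ici 0) ∧
    ∀ t, 0 ≤ t → t ∉ D → ∃ v ∈ V, HasDerivWithinAt x v (Ici 0) t}

/-- The affine family `A(ρ) = A₀ + ∑ i, ρ i • A₁ i`. -/
def affineFamily {n p : ℕ} (A₀ : Matrix (Fin n) (Fin n) ℝ)
    (A₁ : Fin p → Matrix (Fin n) (Fin n) ℝ) (ρ : Fin p → ℝ) : Matrix (Fin n) (Fin n) ℝ :=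
  A₀ + ∑ i, ρ i • A₁ i

/-- All complex eigenvalues of the real matrix `M` have negative real part. -/
def IsHurwitz {n : ℕ} (M : Matrix (Fin n) (Fin n) ℝ) : Prop :=
  ∀ μ ∈ spectrum ℂ (M.map (algebraMap ℝ ℂ)), μ.re < 0

/-- The gains `K` for which `A - B K` is Hurwitz. -/
def stableGains {n m : ℕ} (A : Matrix (Fin n) (Fin n) ℝ) (B : Matrix (Fin n) (Fin m) ℝ) :
    Set (Matrix (Fin m) (Fin n) ℝ) :=
  {K | IsHurwitz (A - B * K)}

/-- The gains that stabilize every frozen system `(A(ρ), B)`, `ρ ∈ P`. -/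
def commonStableGains {n m p : ℕ} (A : (Fin p → ℝ) → Matrix (Fin n) (Fin n) ℝ)
    (B : Matrix (Fin n) (Fin m) ℝ) (P : Set (Fin p → ℝ)) : Set (Matrix (Fin m) (Fin n) ℝ) :=
  ⋂ ρ ∈ P, stableGains (A ρ) B

/-- The solution `X` of the Lyapunov equation `Mᵀ X + X M + W = 0` (it exists and is unique when
`M` is Hurwitz; otherwise some solution, or an arbitrary matrix if there is none). -/
def lyapunovSolution {n : ℕ} (M W : Matrix (Fin n) (Fin n) ℝ) : Matrix (Fin n) (Fin n) ℝ :=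
  Classical.epsilon fun X => Mᵀ * X + X * M + W = 0

/-- The cost matrix `P_K`: `A_Kᵀ P + P A_K + Q + Kᵀ R K = 0` with `A_K = A - B K`. -/
def costMatrix {n m : ℕ} (A : Matrix (Fin n) (Fin n) ℝ) (B : Matrix (Fin n) (Fin m) ℝ)
    (Q : Matrix (Fin n) (Fin n) ℝ) (R : Matrix (Fin m) (Fin m) ℝ)
    (K : Matrix (Fin m) (Fin n) ℝ) : Matrix (Fin n) (Fin n) ℝ :=
  lyapunovSolution (A - B * K) (Q + Kᵀ * R * K)

/-- The matrix `Y_K`: `A_K Y + Y A_Kᵀ + I = 0` with `A_K = A - B K`. -/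
def gramMatrix {n m : ℕ} (A : Matrix (Fin n) (Fin n) ℝ) (B : Matrix (Fin n) (Fin m) ℝ)
    (K : Matrix (Fin m) (Fin n) ℝ) : Matrix (Fin n) (Fin n) ℝ :=
  lyapunovSolution (A - B * K)ᵀ 1

/-- The policy gradient `2 (R K - Bᵀ P_K) Y_K` of the LQR cost `K ↦ tr P_K`. -/
def policyGradient {n m : ℕ} (A : Matrix (Fin n) (Fin n) ℝ) (B : Matrix (Fin n) (Fin m) ℝ)
    (Q : Matrix (Fin n) (Fin n) ℝ) (R : Matrix (Fin m) (Fin m) ℝ)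
    (K : Matrix (Fin m) (Fin n) ℝ) : Matrix (Fin m) (Fin n) ℝ :=
  (2 : ℝ) • ((R * K - Bᵀ * costMatrix A B Q R K) * gramMatrix A B K)

/-- The Jacobian matrix of `g` at `x`. -/
def jacobian {ι κ : Type*} [Fintype ι] [Fintype κ] [DecidableEq ι]
    (g : (ι → ℝ) → κ → ℝ) (x : ι → ℝ) : Matrix κ ι ℝ :=
  LinearMap.toMatrix' (fderiv ℝ g x : (ι → ℝ) →ₗ[ℝ] κ → ℝ)

/-- `M(x) = I - Jᵀ F⁻¹ J` with `J` the Jacobian matrix of `g` at `x` and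
`F = 2 diag(g(x)) + J Jᵀ`. -/
def projectionMatrix {ι κ : Type*} [Fintype ι] [Fintype κ] [DecidableEq ι] [DecidableEq κ]
    (g : (ι → ℝ) → κ → ℝ) (x : ι → ℝ) : Matrix ι ι ℝ :=
  1 - (jacobian g x)ᵀ *
    ((2 : ℝ) • Matrix.diagonal (g x) + jacobian g x * (jacobian g x)ᵀ)⁻¹ * jacobian g x

/-- The hyperrectangle `∏ i, [l i, u i]`. -/
def hyperrectangle {ι : Type*} (l u : ι → ℝ) : Set (ι → ℝ) :=
  Set.pi univ fun i => Icc (l i) (u i)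

/-- The constraint functions `x i - l i` and `u i - x i` of the hyperrectangle. -/
def boxConstraint {ι : Type*} (l u : ι → ℝ) (x : ι → ℝ) : ι ⊕ ι → ℝ :=
  Sum.elim (fun i => x i - l i) (fun i => u i - x i)

/-- The projected gradient `M(K) vec(2 (R K - Bᵀ P_K) Y_K)` of the LQR cost of `(A, B)` onto the
hyperrectangle with bounds `l`, `u`. -/
def projectedGradient {n m : ℕ} (A : Matrix (Fin n) (Fin n) ℝ) (B : Matrix (Fin n) (Fin m) ℝ)
    (Q : Matrix (Fin n) (Fin n) ℝ) (R : Matrix (Fin m) (Fin m) ℝ) (l u : Fin n × Fin m → ℝ)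
    (K : Matrix (Fin m) (Fin n) ℝ) : Fin n × Fin m → ℝ :=
  projectionMatrix (boxConstraint l u) K.vec *ᵥ (policyGradient A B Q R K).vec

/-- `K` is, on the time set `J`, a trajectory of the dynamic controller
`vec(K') = -α ∇_C f_K(ρ(t))`, `vec(K(0)) ∈ int C`, in the sense of Carathéodory, that is, it solves
the integrated equation. -/
structure IsControllerTrajectory {n m p : ℕ} (A : (Fin p → ℝ) → Matrix (Fin n) (Fin n) ℝ)
    (B : Matrix (Fin n) (Fin m) ℝ) (Q : Matrix (Fin n) (Fin n) ℝ) (R : Matrix (Fin m) (Fin m) ℝ)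
    (l u : Fin n × Fin m → ℝ) (α : ℝ) (ρ : ℝ → Fin p → ℝ) (J : Set ℝ)
    (K : ℝ → Matrix (Fin m) (Fin n) ℝ) : Prop where
  initial : (K 0).vec ∈ interior (hyperrectangle l u)
  integrable : ∀ t ∈ J, IntervalIntegrable
    (fun τ => projectedGradient (A (ρ τ)) B Q R l u (K τ)) volume 0 t
  equation : ∀ t ∈ J, (K t).vec =
    (K 0).vec - α • ∫ τ in (0 : ℝ)..t, projectedGradient (A (ρ τ)) B Q R l u (K τ)

end ProjectedLQR

end

/-!
The projection matrix of a box is diagonal: with `a` and `b` the distances of a coordinate to its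
two bounds, its entry is `2ab / (2ab + a + b)`, which is at most `2a` and at most `2b`. For a
Hurwitz matrix `M`, the spectra of `Mᵀ` and `-M` are disjoint, so the Lyapunov operator
`X ↦ Mᵀ X + X M` is invertible and the policy gradient is a smooth function of the gain and of the
system matrix. On the compact box the controller field is therefore Lipschitz, and each of its
coordinates is dominated by a multiple `c` of the distance to each facet orthogonal to it.

Composing the field with the nearest-point map of the box makes it globally Lipschitz, and Picard
iteration in an exponentially weighted norm gives a solution on the whole half-line. Its distance
`φ` to a facet satisfies `|φ'| ≤ c φ`, and a function with this property that vanishes somewhere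
vanishes everywhere; hence the solution never leaves the interior, where the extension does not
change the field. The rate polytope is the box on which these bounds hold, of half-widths
`c (u - l)`.
-/

open Filter Topology
open scoped NNReal BoundedContinuousFunction ContDiff

namespace ProjectedLQR

section Primitive

variable {E F : Type*} [NormedAddCommGroup E] [NormedSpace ℝ E]
  [NormedAddCommGroup F] [NormedSpace ℝ F]

/-- `x` is an indefinite integral of `g` on the time set `J`. A Carathéodory solution on `J` of
the differential equation `x' = h τ x` is an `x` with `IsPrimitiveOn x (fun τ => h τ (x τ)) J`. -/
structure IsPrimitiveOn (x g : ℝ → E) (J : Set ℝ) : Prop where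
  intervalIntegrable : ∀ s ∈ J, ∀ t ∈ J, IntervalIntegrable g volume s t
  integral_eq_sub : ∀ s ∈ J, ∀ t ∈ J, ∫ τ in s..t, g τ = x t - x s

namespace IsPrimitiveOn

variable {x y g k : ℝ → E} {J J' : Set ℝ} {a : ℝ}

theorem of_basepoint (hg : ∀ t ∈ J, IntervalIntegrable g volume a t)
    (hx : ∀ t ∈ J, x t = x a + ∫ τ in a..t, g τ) : IsPrimitiveOn x g J where
  intervalIntegrable s hs t ht := (hg s hs).symm.trans (hg t ht)
  integral_eq_sub s hs t ht := by
    rw [← intervalIntegral.integral_interval_sub_left (hg t ht) (hg s hs), hx t ht, hx s hs]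
    abel

theorem mono (hx : IsPrimitiveOn x g J) (hJ : J' ⊆ J) : IsPrimitiveOn x g J' where
  intervalIntegrable s hs t ht := hx.intervalIntegrable s (hJ hs) t (hJ ht)
  integral_eq_sub s hs t ht := hx.integral_eq_sub s (hJ hs) t (hJ ht)

theorem congr (hx : IsPrimitiveOn x g J) (hJ : J.OrdConnected) (hgk : EqOn g k J) :
    IsPrimitiveOn x k J where
  intervalIntegrable s hs t ht := (hx.intervalIntegrable s hs t ht).congr_uIoo
    (hgk.mono (uIoo_subset_uIcc_self.trans (hJ.uIcc_subset hs ht)))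
  integral_eq_sub s hs t ht := by
    rw [← hx.integral_eq_sub s hs t ht]
    exact (intervalIntegral.integral_congr (hgk.mono (hJ.uIcc_subset hs ht))).symm

theorem sub (hx : IsPrimitiveOn x g J) (hy : IsPrimitiveOn y k J) :
    IsPrimitiveOn (fun t => x t - y t) (fun t => g t - k t) J where
  intervalIntegrable s hs t ht :=
    (hx.intervalIntegrable s hs t ht).sub (hy.intervalIntegrable s hs t ht)
  integral_eq_sub s hs t ht := by
    rw [intervalIntegral.integral_sub (hx.intervalIntegrable s hs t ht)
      (hy.intervalIntegrable s hs t ht), hx.integral_eq_sub s hs t ht, hy.integral_eq_sub s hs t ht]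
    abel

theorem sub_const (hx : IsPrimitiveOn x g J) (v : E) : IsPrimitiveOn (fun t => x t - v) g J where
  intervalIntegrable := hx.intervalIntegrable
  integral_eq_sub s hs t ht := by rw [hx.integral_eq_sub s hs t ht, sub_sub_sub_cancel_right]

theorem const_sub (hx : IsPrimitiveOn x g J) (v : E) :
    IsPrimitiveOn (fun t => v - x t) (fun t => -g t) J where
  intervalIntegrable s hs t ht := (hx.intervalIntegrable s hs t ht).neg
  integral_eq_sub s hs t ht := by
    rw [intervalIntegral.integral_neg, hx.integral_eq_sub s hs t ht]
    abel

theorem clm_comp [CompleteSpace E] [CompleteSpace F] (hx : IsPrimitiveOn x g J) (T : E →L[ℝ] F) :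
    IsPrimitiveOn (fun t => T (x t)) (fun t => T (g t)) J where
  intervalIntegrable s hs t ht :=
    ⟨T.integrable_comp (hx.intervalIntegrable s hs t ht).1,
      T.integrable_comp (hx.intervalIntegrable s hs t ht).2⟩
  integral_eq_sub s hs t ht := by
    rw [T.intervalIntegral_comp_comm (hx.intervalIntegrable s hs t ht),
      hx.integral_eq_sub s hs t ht, map_sub]

end IsPrimitiveOn

theorem exists_Icc_mem_nhdsWithin {α : Type*} [LinearOrder α] [TopologicalSpace α]
    [OrderTopology α] {J : Set α} {t : α} (ht : t ∈ J) :
    ∃ a ∈ J, ∃ b ∈ J, Icc a b ∈ 𝓝[J] t := by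
  obtain ⟨a, haJ, ha⟩ : ∃ a ∈ J, ∀ᶠ r in 𝓝[J] t, a ≤ r := by
    by_cases! h : ∃ a ∈ J, a < t
    · obtain ⟨a, haJ, hat⟩ := h
      exact ⟨a, haJ, nhdsWithin_le_nhds (Ici_mem_nhds hat)⟩
    · exact ⟨t, ht, eventually_mem_nhdsWithin.mono h⟩
  obtain ⟨b, hbJ, hb⟩ : ∃ b ∈ J, ∀ᶠ r in 𝓝[J] t, r ≤ b := by
    by_cases! h : ∃ b ∈ J, t < b
    · obtain ⟨b, hbJ, htb⟩ := h
      exact ⟨b, hbJ, nhdsWithin_le_nhds (Iic_mem_nhds htb)⟩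
    · exact ⟨t, ht, eventually_mem_nhdsWithin.mono h⟩
  exact ⟨a, haJ, b, hbJ, ha.and hb⟩

namespace IsPrimitiveOn

variable {x g : ℝ → E} {J : Set ℝ} {a t C : ℝ}

theorem continuousOn (hx : IsPrimitiveOn x g J) : ContinuousOn x J := by
  intro t ht
  obtain ⟨a, ha, b, hb, hab⟩ := exists_Icc_mem_nhdsWithin ht
  have htab : t ∈ Icc a b := mem_of_mem_nhdsWithin ht hab
  have hprim : ContinuousWithinAt (fun r => ∫ τ in a..r, g τ) (Icc a b) t := by
    have := intervalIntegral.continuousOn_primitive_interval' (hx.intervalIntegrable a ha b hb)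
      left_mem_uIcc
    rw [uIcc_of_le (htab.1.trans htab.2)] at this
    exact this t htab
  have hxa : ∀ r ∈ J, x r = x a + ∫ τ in a..r, g τ := fun r hr => by
    rw [hx.integral_eq_sub a ha r hr, add_sub_cancel]
  exact (continuousWithinAt_const.add (hprim.mono_of_mem_nhdsWithin hab)).congr hxa (hxa t ht)

theorem hasDerivWithinAt [CompleteSpace E] (hx : IsPrimitiveOn x g J) (hJ : J.OrdConnected)
    (ht : t ∈ J) (hg : ContinuousWithinAt g J t) : HasDerivWithinAt x (g t) J t := by
  rw [hasDerivWithinAt_iff_isLittleO, Asymptotics.isLittleO_iff]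
  intro ε hε
  obtain ⟨δ, hδ, hδg⟩ := Metric.continuousWithinAt_iff.1 hg ε hε
  filter_upwards [self_mem_nhdsWithin, nhdsWithin_le_nhds (Metric.ball_mem_nhds t hδ)]
    with s hs hsδ
  have hint : ∫ τ in t..s, (g τ - g t) = x s - x t - (s - t) • g t := by
    rw [intervalIntegral.integral_sub (hx.intervalIntegrable t ht s hs) (by simp),
      hx.integral_eq_sub t ht s hs, intervalIntegral.integral_const]
  rw [← hint]
  refine intervalIntegral.norm_integral_le_of_norm_le_const fun τ hτ => ?_
  have hτ' := uIoc_subset_uIcc hτ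
  rw [← dist_eq_norm]
  refine (hδg (hJ.uIcc_subset ht hs hτ') ?_).le
  exact (abs_sub_left_of_mem_uIcc hτ').trans_lt hsδ

theorem eventuallyEq_zero (hx : IsPrimitiveOn x g J) (hJ : J.OrdConnected) (ha : a ∈ J)
    (h0 : x a = 0) (hle : ∀ᶠ t in 𝓝[J] a, ‖g t‖ ≤ C * ‖x t‖) : x =ᶠ[𝓝[J] a] 0 := by
  obtain ⟨ε, hε, hεC⟩ := Metric.mem_nhdsWithin_iff.1 hle
  have hsmall : ∀ᶠ t in 𝓝 a, |C| * |t - a| < 1 := by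
    have hcont : ContinuousAt (fun t => |C| * |t - a|) a := by fun_prop
    exact hcont.eventually_lt continuousAt_const (by simp)
  filter_upwards [self_mem_nhdsWithin, nhdsWithin_le_nhds (Metric.ball_mem_nhds a hε),
    nhdsWithin_le_nhds hsmall] with t ht htε htC
  have hsub : uIcc a t ⊆ J := hJ.uIcc_subset ha ht
  obtain ⟨r, hr, hmax⟩ := isCompact_uIcc.exists_isMaxOn nonempty_uIcc
    (hx.continuousOn.norm.mono hsub)
  have hdist : |r - a| ≤ |t - a| := abs_sub_left_of_mem_uIcc hr
  have hbound : ‖x r‖ ≤ |C| * ‖x r‖ * |r - a| := by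
    have hxr : x r = ∫ τ in a..r, g τ := by
      rw [hx.integral_eq_sub a ha r (hsub hr), h0, sub_zero]
    conv_lhs => rw [hxr]
    refine intervalIntegral.norm_integral_le_of_norm_le_const fun τ hτ => ?_
    have hτ' := uIcc_subset_uIcc_left hr (uIoc_subset_uIcc hτ)
    calc ‖g τ‖ ≤ C * ‖x τ‖ :=
          hεC ⟨(abs_sub_left_of_mem_uIcc hτ').trans_lt htε, hsub hτ'⟩
      _ ≤ |C| * ‖x r‖ := mul_le_mul (le_abs_self C) (hmax hτ') (norm_nonneg _) (abs_nonneg C)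
  have hr0 : ‖x r‖ ≤ 0 := by
    by_contra! hpos
    have : |C| * |r - a| ≤ |C| * |t - a| := by gcongr
    nlinarith
  exact norm_le_zero_iff.1 ((hmax right_mem_uIcc).trans hr0)

theorem eqOn_zero (hx : IsPrimitiveOn x g J) (hJ : J.OrdConnected) (ha : a ∈ J) (h0 : x a = 0)
    (hle : ∀ s ∈ J, x s = 0 → ∀ᶠ t in 𝓝[J] s, ‖g t‖ ≤ C * ‖x t‖) : EqOn x 0 J := by
  have : PreconnectedSpace J := Subtype.preconnectedSpace hJ.isPreconnected
  set Z : Set J := {t | x t = 0}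
  have hclosed : IsClosed Z :=
    isClosed_singleton.preimage (continuousOn_iff_continuous_domRestrict.1 hx.continuousOn)
  have hopen : IsOpen Z := isOpen_iff_mem_nhds.2 fun s hs => by
    rw [mem_nhds_subtype_iff_nhdsWithin]
    filter_upwards [hx.eventuallyEq_zero hJ s.2 hs (hle s s.2 hs), self_mem_nhdsWithin]
      with t ht htJ
    exact ⟨⟨t, htJ⟩, ht, rfl⟩
  have huniv : Z = univ := IsClopen.eq_univ ⟨hclosed, hopen⟩ ⟨⟨a, ha⟩, h0⟩
  exact fun t ht => (huniv ▸ mem_univ (⟨t, ht⟩ : J) : (⟨t, ht⟩ : J) ∈ Z)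

theorem pos {φ g : ℝ → ℝ} (hφ : IsPrimitiveOn φ g J) (hJ : J.OrdConnected)
    (hle : ∀ t ∈ J, |g t| ≤ C * |φ t|) (ha : a ∈ J) (h0 : 0 < φ a) : ∀ t ∈ J, 0 < φ t := by
  intro t ht
  by_contra! hneg
  obtain ⟨s, hs, hs0⟩ := hJ.isPreconnected.intermediate_value ht ha hφ.continuousOn ⟨hneg, h0.le⟩
  exact h0.ne' (hφ.eqOn_zero hJ hs hs0 (fun _ _ _ => eventually_mem_nhdsWithin.mono hle) ha)

theorem eqOn_of_lipschitzOnWith {h : ℝ → E → E} {U : Set E} {L : ℝ≥0} {x y : ℝ → E}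
    (hlip : ∀ t ∈ J, LipschitzOnWith L (h t) U)
    (hx : IsPrimitiveOn x (fun t => h t (x t)) J) (hy : IsPrimitiveOn y (fun t => h t (y t)) J)
    (hxU : ∀ t ∈ J, x t ∈ interior U) (hJ : J.OrdConnected) (ha : a ∈ J) (h0 : y a = x a) :
    EqOn y x J := by
  refine fun t ht => sub_eq_zero.1
    ((hy.sub hx).eqOn_zero (C := L) hJ ha (sub_eq_zero.2 h0) (fun s hs hs0 => ?_) ht)
  have hyU : ∀ᶠ t in 𝓝[J] s, y t ∈ U := (hy.continuousOn s hs).eventually_mem <| by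
    rw [sub_eq_zero.1 hs0]
    exact mem_interior_iff_mem_nhds.1 (hxU s hs)
  filter_upwards [hyU, self_mem_nhdsWithin] with t htU ht
  exact (hlip t ht).norm_sub_le htU (interior_subset (hxU t ht))

end IsPrimitiveOn

end Primitive

section Picard

variable {E : Type*} [NormedAddCommGroup E]

theorem norm_exp_neg_smul_integral_le [NormedSpace ℝ E] {g : ℝ → E} {C r s : ℝ} (hr : 0 < r)
    (hs : 0 ≤ s) (hg : ∀ τ ∈ Icc 0 s, ‖g τ‖ ≤ C * Real.exp (r * τ)) :
    ‖Real.exp (-(r * s)) • ∫ τ in (0 : ℝ)..s, g τ‖ ≤ C / r := by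
  have hC : 0 ≤ C := by simpa using (norm_nonneg _).trans (hg 0 (left_mem_Icc.2 hs))
  have hexp : ∫ τ in (0 : ℝ)..s, C * Real.exp (r * τ) = C / r * (Real.exp (r * s) - 1) := by
    rw [intervalIntegral.integral_const_mul,
      intervalIntegral.integral_comp_mul_left (fun τ => Real.exp τ) hr.ne', integral_exp, mul_zero,
      Real.exp_zero, smul_eq_mul, ← mul_assoc, div_eq_mul_inv]
  have hint : ‖∫ τ in (0 : ℝ)..s, g τ‖ ≤ C / r * (Real.exp (r * s) - 1) := by
    rw [← hexp]
    exact intervalIntegral.norm_integral_le_of_norm_le hs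
      (.of_forall fun τ hτ => hg τ (Ioc_subset_Icc_self hτ))
      (Continuous.intervalIntegrable (by fun_prop) _ _)
  calc ‖Real.exp (-(r * s)) • ∫ τ in (0 : ℝ)..s, g τ‖
      = Real.exp (-(r * s)) * ‖∫ τ in (0 : ℝ)..s, g τ‖ := by
        rw [norm_smul, Real.norm_of_nonneg (Real.exp_nonneg _)]
    _ ≤ Real.exp (-(r * s)) * (C / r * Real.exp (r * s)) := by
        gcongr
        exact hint.trans (by gcongr; linarith)
    _ = C / r := by rw [mul_left_comm, ← Real.exp_add, neg_add_cancel, Real.exp_zero, mul_one]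

/-- A vector field `h`, depending on the time `τ ≥ 0`, to which Picard iteration applies on the
whole half-line: uniformly Lipschitz with constant `L`, bounded by `c` at the origin, and measurable
in time along continuous curves. -/
structure IsCaratheodoryField (h : ℝ → E → E) (L : ℝ≥0) (c : ℝ) : Prop where
  lipschitzWith : ∀ τ, 0 ≤ τ → LipschitzWith L (h τ)
  norm_apply_zero_le : ∀ τ, 0 ≤ τ → ‖h τ 0‖ ≤ c
  aestronglyMeasurable_comp : ∀ x : ℝ → E, Continuous x →
    AEStronglyMeasurable (fun τ => h τ (x τ)) (volume.restrict (Ici 0))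

namespace IsCaratheodoryField

variable {h : ℝ → E → E} {L : ℝ≥0} {c : ℝ}

theorem norm_le (hh : IsCaratheodoryField h L c) {τ : ℝ} (hτ : 0 ≤ τ) (x : E) :
    ‖h τ x‖ ≤ c + L * ‖x‖ :=
  calc ‖h τ x‖ ≤ ‖h τ 0‖ + ‖h τ x - h τ 0‖ := norm_le_norm_add_norm_sub' _ _
    _ ≤ c + L * ‖x‖ := by
        gcongr
        · exact hh.norm_apply_zero_le τ hτ
        · simpa using (hh.lipschitzWith τ hτ).norm_sub_le x 0

theorem intervalIntegrable (hh : IsCaratheodoryField h L c) {x : ℝ → E} (hx : Continuous x) {t : ℝ}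
    (ht : 0 ≤ t) : IntervalIntegrable (fun τ => h τ (x τ)) volume 0 t := by
  have hsub : uIoc 0 t ⊆ Ici 0 := (uIoc_of_le ht).trans_subset fun _ hτ => hτ.1.le
  refine IntervalIntegrable.mono_fun' (g := fun τ => c + L * ‖x τ‖)
    (Continuous.intervalIntegrable (by fun_prop) _ _)
    ((hh.aestronglyMeasurable_comp x hx).mono_measure (Measure.restrict_mono hsub le_rfl))
    (ae_restrict_of_forall_mem measurableSet_uIoc fun τ hτ => hh.norm_le (hsub hτ) _)

variable [NormedSpace ℝ E]

/-- The Picard map in the unknown `z` with `x τ = x₀ + exp (r τ) z τ`; for `r > L` it contracts the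
uniform norm. -/
theorem exists_picardMap (hh : IsCaratheodoryField h L c) {r : ℝ} (hr : 0 < r) (x₀ : E) :
    ∃ Φ : (ℝ →ᵇ E) → (ℝ →ᵇ E), ∀ z t, Φ z t =
      Real.exp (-(r * max t 0)) • ∫ τ in 0..max t 0, h τ (x₀ + Real.exp (r * τ) • z τ) := by
  suffices ∀ z : ℝ →ᵇ E, ∃ w : ℝ →ᵇ E, ∀ t, w t =
      Real.exp (-(r * max t 0)) • ∫ τ in 0..max t 0, h τ (x₀ + Real.exp (r * τ) • z τ) from
    ⟨fun z => (this z).choose, fun z => (this z).choose_spec⟩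
  intro z
  set g : ℝ → E := fun τ => h τ (x₀ + Real.exp (r * τ) • z τ)
  have hprim : IsPrimitiveOn (fun t => ∫ τ in (0 : ℝ)..t, g τ) g (Ici 0) :=
    .of_basepoint (a := 0) (fun t ht => hh.intervalIntegrable (by fun_prop) ht) (by simp)
  have hcont : Continuous fun t => Real.exp (-(r * max t 0)) • ∫ τ in 0..max t 0, g τ := by
    refine Continuous.smul (by fun_prop) ?_
    exact hprim.continuousOn.comp_continuous (by fun_prop) fun t => le_max_right t 0
  have hg : ∀ τ, 0 ≤ τ → ‖g τ‖ ≤ (c + L * (‖x₀‖ + ‖z‖)) * Real.exp (r * τ) := by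
    intro τ hτ
    have hc : 0 ≤ c := (norm_nonneg _).trans (hh.norm_apply_zero_le τ hτ)
    have hexp : 1 ≤ Real.exp (r * τ) := Real.one_le_exp (by positivity)
    calc ‖g τ‖ ≤ c + L * ‖x₀ + Real.exp (r * τ) • z τ‖ := hh.norm_le hτ _
      _ ≤ c + L * (‖x₀‖ + Real.exp (r * τ) * ‖z‖) := by
          gcongr
          refine (norm_add_le _ _).trans ?_
          rw [norm_smul, Real.norm_of_nonneg (Real.exp_nonneg _)]
          gcongr
          exact z.norm_coe_le_norm τ
      _ ≤ c * Real.exp (r * τ) + L * (‖x₀‖ * Real.exp (r * τ) + Real.exp (r * τ) * ‖z‖) := by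
          gcongr <;> exact le_mul_of_one_le_right (by positivity) hexp
      _ = (c + L * (‖x₀‖ + ‖z‖)) * Real.exp (r * τ) := by ring
  exact ⟨.ofNormedAddCommGroup _ hcont _ fun t =>
    norm_exp_neg_smul_integral_le hr (le_max_right t 0) fun τ hτ => hg τ hτ.1, fun t => rfl⟩

theorem exists_contracting_picardMap (hh : IsCaratheodoryField h L c) (x₀ : E) :
    ∃ r : ℝ, ∃ Φ : (ℝ →ᵇ E) → (ℝ →ᵇ E), ContractingWith (1 / 2) Φ ∧ ∀ z t, Φ z t =
      Real.exp (-(r * max t 0)) • ∫ τ in 0..max t 0, h τ (x₀ + Real.exp (r * τ) • z τ) := by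
  have hr : 0 < 2 * (L : ℝ) + 1 := by positivity
  obtain ⟨Φ, hΦ⟩ := hh.exists_picardMap hr x₀
  refine ⟨2 * L + 1, Φ, ⟨by norm_num, LipschitzWith.of_dist_le_mul fun z w => ?_⟩, hΦ⟩
  refine (BoundedContinuousFunction.dist_le (by positivity)).2 fun t => ?_
  set s := max t 0
  have hs : 0 ≤ s := le_max_right t 0
  have hlip : ∀ τ ∈ Icc 0 s, ‖h τ (x₀ + Real.exp ((2 * L + 1) * τ) • z τ) -
      h τ (x₀ + Real.exp ((2 * L + 1) * τ) • w τ)‖ ≤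
      L * dist z w * Real.exp ((2 * L + 1) * τ) := by
    intro τ hτ
    refine ((hh.lipschitzWith τ hτ.1).norm_sub_le _ _).trans ?_
    rw [add_sub_add_left_eq_sub, ← smul_sub, norm_smul, Real.norm_of_nonneg (Real.exp_nonneg _),
      ← dist_eq_norm, mul_assoc, mul_comm (dist z w)]
    gcongr
    exact BoundedContinuousFunction.dist_coe_le_dist τ
  rw [hΦ, hΦ, dist_eq_norm, ← smul_sub, ← intervalIntegral.integral_sub
    (hh.intervalIntegrable (by fun_prop) hs) (hh.intervalIntegrable (by fun_prop) hs)]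
  refine (norm_exp_neg_smul_integral_le hr hs hlip).trans ?_
  rw [div_le_iff₀ hr]
  push_cast
  nlinarith [dist_nonneg (x := z) (y := w)]

theorem exists_isPrimitiveOn [CompleteSpace E] (hh : IsCaratheodoryField h L c) (x₀ : E) :
    ∃ x : ℝ → E, x 0 = x₀ ∧ IsPrimitiveOn x (fun τ => h τ (x τ)) (Ici 0) := by
  obtain ⟨r, Φ, hcontr, hΦ⟩ := hh.exists_contracting_picardMap x₀
  obtain ⟨z, hz, -⟩ := hcontr.exists_fixedPoint 0 (edist_ne_top _ _)
  set x : ℝ → E := fun t => x₀ + Real.exp (r * t) • z t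
  have hfix : ∀ t, 0 ≤ t → z t = Real.exp (-(r * t)) • ∫ τ in (0 : ℝ)..t, h τ (x τ) := by
    intro t ht
    conv_lhs => rw [← hz.eq, hΦ, max_eq_left ht]
  have hxt : ∀ t, 0 ≤ t → x t = x₀ + ∫ τ in (0 : ℝ)..t, h τ (x τ) := by
    intro t ht
    calc x t = x₀ + Real.exp (r * t) • Real.exp (-(r * t)) • ∫ τ in (0 : ℝ)..t, h τ (x τ) := by
          rw [← hfix t ht]
      _ = x₀ + ∫ τ in (0 : ℝ)..t, h τ (x τ) := by
          rw [smul_smul, ← Real.exp_add, add_neg_cancel, Real.exp_zero, one_smul]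
  have hx0 : x 0 = x₀ := by simpa using hxt 0 le_rfl
  have hcont : Continuous x := by fun_prop
  exact ⟨x, hx0, .of_basepoint (fun t ht => hh.intervalIntegrable hcont ht)
    fun t ht => by rw [hx0]; exact hxt t ht⟩

end IsCaratheodoryField

end Picard

section Box

variable {ι : Type*} {l u x : ι → ℝ}

theorem IsPolytope.isCompact {S : Set (ι → ℝ)} (hS : IsPolytope S) : IsCompact S := by
  obtain ⟨F, hF, rfl⟩ := hS
  exact hF.isCompact_convexHull ℝ

theorem isCompact_hyperrectangle (l u : ι → ℝ) : IsCompact (hyperrectangle l u) :=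
  isCompact_univ_pi fun _ => isCompact_Icc

theorem isPolytope_hyperrectangle [Finite ι] (hlu : ∀ i, l i ≤ u i) :
    IsPolytope (hyperrectangle l u) := by
  refine ⟨Set.pi univ fun i => {l i, u i}, Finite.pi fun i => by simp, ?_⟩
  rw [convexHull_pi]
  simp [hyperrectangle, convexHull_pair, segment_eq_Icc (hlu _)]

theorem mem_interior_hyperrectangle [Finite ι] :
    x ∈ interior (hyperrectangle l u) ↔ ∀ i, l i < x i ∧ x i < u i := by
  rw [hyperrectangle, interior_pi_set finite_univ]
  simp

/-- The nearest point of `hyperrectangle l u`, used to extend a field from the hyperrectangle to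
the whole space without losing its Lipschitz constant. -/
noncomputable def clamp (hlu : ∀ i, l i ≤ u i) (x : ι → ℝ) : ι → ℝ :=
  fun i => projIcc (l i) (u i) (hlu i) (x i)

theorem clamp_mem (hlu : ∀ i, l i ≤ u i) (x : ι → ℝ) : clamp hlu x ∈ hyperrectangle l u :=
  fun i _ => (projIcc (l i) (u i) (hlu i) (x i)).2

theorem clamp_of_mem (hlu : ∀ i, l i ≤ u i) (hx : x ∈ hyperrectangle l u) : clamp hlu x = x :=
  funext fun i => congrArg Subtype.val (projIcc_of_mem (hlu i) (hx i (mem_univ i)))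

theorem abs_clamp_sub_clamp_le (hlu : ∀ i, l i ≤ u i) (x y : ι → ℝ) (i : ι) :
    |clamp hlu x i - clamp hlu y i| ≤ |x i - y i| :=
  ((LipschitzWith.projIcc (hlu i)).dist_le_mul (x i) (y i)).trans_eq (one_mul _)

theorem lipschitzWith_clamp [Fintype ι] (hlu : ∀ i, l i ≤ u i) : LipschitzWith 1 (clamp hlu) :=
  .mk_one fun x y => (dist_pi_le_iff dist_nonneg).2 fun i =>
    (abs_clamp_sub_clamp_le hlu x y i).trans (dist_le_pi_dist x y i)

theorem clamp_sub_left_le (hlu : ∀ i, l i ≤ u i) (x : ι → ℝ) (i : ι) :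
    clamp hlu x i - l i ≤ |x i - l i| := by
  have hl : clamp hlu l = l := clamp_of_mem hlu fun j _ => left_mem_Icc.2 (hlu j)
  simpa only [hl] using (le_abs_self _).trans (abs_clamp_sub_clamp_le hlu x l i)

theorem right_sub_clamp_le (hlu : ∀ i, l i ≤ u i) (x : ι → ℝ) (i : ι) :
    u i - clamp hlu x i ≤ |u i - x i| := by
  have hu : clamp hlu u = u := clamp_of_mem hlu fun j _ => right_mem_Icc.2 (hlu j)
  simpa only [hu] using (le_abs_self _).trans (abs_clamp_sub_clamp_le hlu u x i)

/-- A vector field `h` on `hyperrectangle l u`, depending on the time `τ ≥ 0`, each coordinate of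
which decays at least linearly (with rate `c`) towards the two facets orthogonal to it, so that no
solution started in the interior reaches the boundary. The last field is the measurability in time
that Picard iteration requires. -/
structure IsBarrierField [Fintype ι] (l u : ι → ℝ) (L c : ℝ≥0) (h : ℝ → (ι → ℝ) → ι → ℝ) :
    Prop where
  lipschitzOnWith : ∀ τ, 0 ≤ τ → LipschitzOnWith L (h τ) (hyperrectangle l u)
  abs_le_left : ∀ τ, 0 ≤ τ → ∀ x ∈ hyperrectangle l u, ∀ i, |h τ x i| ≤ c * (x i - l i)
  abs_le_right : ∀ τ, 0 ≤ τ → ∀ x ∈ hyperrectangle l u, ∀ i, |h τ x i| ≤ c * (u i - x i)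
  aestronglyMeasurable_comp : ∀ x : ℝ → ι → ℝ, Continuous x → (∀ τ, x τ ∈ hyperrectangle l u) →
    AEStronglyMeasurable (fun τ => h τ (x τ)) (volume.restrict (Ici 0))

namespace IsBarrierField

variable [Fintype ι] {L c : ℝ≥0} {h : ℝ → (ι → ℝ) → ι → ℝ}

theorem abs_le (hh : IsBarrierField l u L c h) {τ : ℝ} (hτ : 0 ≤ τ)
    (hx : x ∈ hyperrectangle l u) (i : ι) : |h τ x i| ≤ c * (u i - l i) :=
  (hh.abs_le_left τ hτ x hx i).trans (by gcongr; exact (hx i (mem_univ i)).2)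

theorem isCaratheodoryField_comp_clamp (hh : IsBarrierField l u L c h) (hlu : ∀ i, l i ≤ u i) :
    IsCaratheodoryField (fun τ x => h τ (clamp hlu x)) L (c * ‖u - l‖) where
  lipschitzWith τ hτ := by
    have hclamp := (lipschitzWith_clamp hlu).lipschitzOnWith (s := univ)
    have := (hh.lipschitzOnWith τ hτ).comp hclamp fun x _ => clamp_mem hlu x
    rwa [mul_one, lipschitzOnWith_univ] at this
  norm_apply_zero_le τ hτ := (pi_norm_le_iff_of_nonneg (by positivity)).2 fun i => by
    refine (hh.abs_le hτ (clamp_mem hlu 0) i).trans ?_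
    gcongr
    exact (le_abs_self _).trans (norm_le_pi_norm (u - l) i)
  aestronglyMeasurable_comp x hx := hh.aestronglyMeasurable_comp _
    ((lipschitzWith_clamp hlu).continuous.comp hx) fun τ => clamp_mem hlu (x τ)

theorem exists_isPrimitiveOn (hh : IsBarrierField l u L c h) {x₀ : ι → ℝ}
    (hx₀ : x₀ ∈ interior (hyperrectangle l u)) :
    ∃ x : ℝ → ι → ℝ, x 0 = x₀ ∧ (∀ t ∈ Ici (0 : ℝ), x t ∈ interior (hyperrectangle l u)) ∧
      IsPrimitiveOn x (fun τ => h τ (x τ)) (Ici 0) := by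
  have hx₀' := mem_interior_hyperrectangle.1 hx₀
  have hlu : ∀ i, l i ≤ u i := fun i => ((hx₀' i).1.trans (hx₀' i).2).le
  obtain ⟨x, hx0, hx⟩ := (hh.isCaratheodoryField_comp_clamp hlu).exists_isPrimitiveOn x₀
  have hcoord : ∀ i, IsPrimitiveOn (fun t => x t i) (fun τ => h τ (clamp hlu (x τ)) i) (Ici 0) :=
    fun i => hx.clm_comp (ContinuousLinearMap.proj (R := ℝ) i)
  have hleft : ∀ i, ∀ t ∈ Ici (0 : ℝ), 0 < x t i - l i := fun i =>
    ((hcoord i).sub_const (l i)).pos (C := c) ordConnected_Ici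
      (fun t ht => (hh.abs_le_left t ht _ (clamp_mem hlu _) i).trans
        (by gcongr; exact clamp_sub_left_le hlu _ i))
      self_mem_Ici (by rw [hx0, sub_pos]; exact (hx₀' i).1)
  have hright : ∀ i, ∀ t ∈ Ici (0 : ℝ), 0 < u i - x t i := fun i =>
    ((hcoord i).const_sub (u i)).pos (C := c) ordConnected_Ici
      (fun t ht => (abs_neg _).trans_le <| (hh.abs_le_right t ht _ (clamp_mem hlu _) i).trans
        (by gcongr; exact right_sub_clamp_le hlu _ i))
      self_mem_Ici (by rw [hx0, sub_pos]; exact (hx₀' i).2)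
  have hint : ∀ t ∈ Ici (0 : ℝ), x t ∈ interior (hyperrectangle l u) := fun t ht =>
    mem_interior_hyperrectangle.2 fun i => ⟨sub_pos.1 (hleft i t ht), sub_pos.1 (hright i t ht)⟩
  refine ⟨x, hx0, hint, hx.congr ordConnected_Ici fun t ht => ?_⟩
  exact congrArg (h t) (clamp_of_mem hlu (interior_subset (hint t ht)))

theorem mem_interior (hh : IsBarrierField l u L c h) {x : ℝ → ι → ℝ}
    (hx : IsPrimitiveOn x (fun τ => h τ (x τ)) (Ici 0))
    (hx₀ : x 0 ∈ interior (hyperrectangle l u)) {t : ℝ} (ht : t ∈ Ici 0) :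
    x t ∈ interior (hyperrectangle l u) := by
  obtain ⟨y, hy0, hyint, hy⟩ := hh.exists_isPrimitiveOn hx₀
  rw [hy.eqOn_of_lipschitzOnWith hh.lipschitzOnWith hx hyint ordConnected_Ici self_mem_Ici
    hy0.symm ht]
  exact hyint t ht

end IsBarrierField

end Box

section Projection

theorem inv_fromBlocks_diagonal {ι 𝕜 : Type*} [Fintype ι] [DecidableEq ι] [Field 𝕜]
    {a b c d : ι → 𝕜} (hdet : ∀ i, a i * d i - b i * c i ≠ 0) :
    (Matrix.fromBlocks (Matrix.diagonal a) (Matrix.diagonal b) (Matrix.diagonal c)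
        (Matrix.diagonal d))⁻¹ =
      Matrix.fromBlocks (Matrix.diagonal fun i => d i / (a i * d i - b i * c i))
        (Matrix.diagonal fun i => -b i / (a i * d i - b i * c i))
        (Matrix.diagonal fun i => -c i / (a i * d i - b i * c i))
        (Matrix.diagonal fun i => a i / (a i * d i - b i * c i)) := by
  refine Matrix.inv_eq_right_inv ?_
  rw [Matrix.fromBlocks_multiply, ← Matrix.fromBlocks_one]
  simp only [Matrix.diagonal_mul_diagonal, Matrix.diagonal_add]
  rw [← Matrix.diagonal_one, ← Matrix.diagonal_zero]
  congr 2 <;> funext i <;> rw [mul_div_assoc', mul_div_assoc', ← add_div]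
  · rw [div_eq_one_iff_eq (hdet i)]
    ring
  · rw [mul_neg, mul_comm, neg_add_cancel, zero_div]
  · rw [mul_neg, mul_comm, add_neg_cancel, zero_div]
  · rw [div_eq_one_iff_eq (hdet i)]
    ring

variable {ι : Type*} [Fintype ι] [DecidableEq ι] {l u x : ι → ℝ}

theorem jacobian_boxConstraint (l u x : ι → ℝ) :
    jacobian (boxConstraint l u) x = Matrix.fromRows 1 (-1) := by
  have hderiv : HasFDerivAt (boxConstraint l u)
      (ContinuousLinearMap.pi (Sum.elim (fun i => ContinuousLinearMap.proj (R := ℝ) i)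
        (fun i => -ContinuousLinearMap.proj (R := ℝ) i))) x := by
    refine hasFDerivAt_pi.2 fun k => ?_
    rcases k with i | i
    · exact (hasFDerivAt_apply i x).sub_const (l i)
    · exact (hasFDerivAt_apply i x).const_sub (u i)
  rw [jacobian, hderiv.fderiv]
  ext (i | i) j <;> simp [LinearMap.toMatrix'_apply, Matrix.one_apply, Pi.single_apply]

/-- The diagonal entry of the projection matrix of a box belonging to a coordinate at distances
`a` and `b` from its two bounds. -/
noncomputable def facetWeight (a b : ℝ) : ℝ := 2 * a * b / (2 * a * b + (a + b))

theorem facetWeight_comm (a b : ℝ) : facetWeight a b = facetWeight b a := by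
  simp only [facetWeight, mul_right_comm 2 a b, add_comm a b]

theorem facetWeight_nonneg {a b : ℝ} (ha : 0 ≤ a) (hb : 0 ≤ b) : 0 ≤ facetWeight a b := by
  rw [facetWeight]
  positivity

theorem facetWeight_le_left {a b : ℝ} (ha : 0 ≤ a) (hb : 0 ≤ b) : facetWeight a b ≤ 2 * a := by
  refine div_le_of_le_mul₀ (by positivity) (by positivity) ?_
  nlinarith [mul_nonneg (mul_nonneg ha ha) hb, mul_nonneg ha ha]

theorem facetWeight_le_right {a b : ℝ} (ha : 0 ≤ a) (hb : 0 ≤ b) : facetWeight a b ≤ 2 * b :=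
  facetWeight_comm a b ▸ facetWeight_le_left hb ha

theorem projectionMatrix_boxConstraint
    (hx : ∀ i, 2 * (x i - l i) * (u i - x i) + ((x i - l i) + (u i - x i)) ≠ 0) :
    projectionMatrix (boxConstraint l u) x =
      Matrix.diagonal fun i => facetWeight (x i - l i) (u i - x i) := by
  have hF : (2 : ℝ) • Matrix.diagonal (boxConstraint l u x) +
      Matrix.fromRows (1 : Matrix ι ι ℝ) (-1) * (Matrix.fromRows (1 : Matrix ι ι ℝ) (-1))ᵀ =
      Matrix.fromBlocks (Matrix.diagonal fun i => 2 * (x i - l i) + 1)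
        (Matrix.diagonal fun _ => -1) (Matrix.diagonal fun _ => -1)
        (Matrix.diagonal fun i => 2 * (u i - x i) + 1) := by
    ext (i | i) (j | j) <;> by_cases hij : i = j <;>
      simp [boxConstraint, Matrix.transpose_fromRows, hij]
  have hdet : ∀ i, (2 * (x i - l i) + 1) * (2 * (u i - x i) + 1) - (-1) * (-1) =
      2 * (2 * (x i - l i) * (u i - x i) + ((x i - l i) + (u i - x i))) := fun i => by ring
  rw [projectionMatrix, jacobian_boxConstraint, hF, inv_fromBlocks_diagonal fun i => by
      rw [hdet]; exact mul_ne_zero two_ne_zero (hx i),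
    Matrix.transpose_fromRows, Matrix.fromCols_mul_fromBlocks, Matrix.fromCols_mul_fromRows]
  simp only [hdet, Matrix.transpose_one, Matrix.transpose_neg, Matrix.one_mul, Matrix.mul_one,
    Matrix.neg_mul, Matrix.mul_neg, Matrix.diagonal_neg, Matrix.diagonal_add]
  rw [← Matrix.diagonal_one, Matrix.diagonal_sub]
  congr 1
  funext i
  have hd := hx i
  rw [facetWeight]
  generalize x i - l i = a at hd ⊢
  generalize u i - x i = b at hd ⊢
  generalize hd' : 2 * a * b + (a + b) = d at hd ⊢
  field_simp
  linear_combination -2 * hd'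

end Projection

section Lyapunov

theorem eq_zero_of_mul_eq_mul_of_disjoint_spectrum {ι κ 𝕜 : Type*} [Fintype ι] [DecidableEq ι]
    [Fintype κ] [DecidableEq κ] [Field 𝕜] [IsAlgClosed 𝕜] {N : Matrix ι ι 𝕜} {M : Matrix κ κ 𝕜}
    {X : Matrix ι κ 𝕜} (hdisj : Disjoint (spectrum 𝕜 N) (spectrum 𝕜 M)) (hX : N * X = X * M) :
    X = 0 := by
  cases isEmpty_or_nonempty ι
  · exact Subsingleton.elim _ _
  have hpow : ∀ k : ℕ, N ^ k * X = X * M ^ k := by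
    intro k
    induction k with
    | zero => simp
    | succ k ih => rw [pow_succ, Matrix.mul_assoc, hX, ← Matrix.mul_assoc, ih, Matrix.mul_assoc,
        ← pow_succ]
  have hpoly : ∀ q : Polynomial 𝕜, Polynomial.aeval N q * X = X * Polynomial.aeval M q := by
    intro q
    induction q using Polynomial.induction_on' with
    | add a b ha hb => simp only [map_add, Matrix.add_mul, Matrix.mul_add, ha, hb]
    | monomial k a => simp only [Polynomial.aeval_monomial, Algebra.algebraMap_eq_smul_one,
        smul_mul_assoc, one_mul, Matrix.smul_mul, Matrix.mul_smul, hpow]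
  have hunit : IsUnit (Polynomial.aeval M N.charpoly) := by
    rw [← spectrum.zero_notMem_iff 𝕜, spectrum.map_polynomial_aeval_of_degree_pos]
    · rintro ⟨k, hk, hk0⟩
      exact hdisj.le_bot ⟨Matrix.mem_spectrum_iff_isRoot_charpoly.2 hk0, hk⟩
    · rw [Matrix.charpoly_degree_eq_dim]
      exact_mod_cast Fintype.card_pos
  have hzero : X * Polynomial.aeval M N.charpoly = 0 := by
    rw [← hpoly, Matrix.aeval_self_charpoly, Matrix.zero_mul]
  obtain ⟨V, hV⟩ := hunit.exists_right_inv
  rw [← Matrix.mul_one X, ← hV, ← Matrix.mul_assoc, hzero, Matrix.zero_mul]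

variable {n : ℕ} {M X : Matrix (Fin n) (Fin n) ℝ}

theorem IsHurwitz.transpose (hM : IsHurwitz M) : IsHurwitz Mᵀ := by
  intro μ hμ
  refine hM μ ?_
  rw [Matrix.mem_spectrum_iff_isRoot_charpoly] at hμ ⊢
  rwa [Matrix.transpose_map, Matrix.charpoly_transpose] at hμ

theorem IsHurwitz.eq_zero_of_lyapunov (hM : IsHurwitz M) (hX : Mᵀ * X + X * M = 0) : X = 0 := by
  have hdisj : Disjoint (spectrum ℂ (Mᵀ.map (algebraMap ℝ ℂ)))
      (spectrum ℂ (-M.map (algebraMap ℝ ℂ))) := by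
    refine Set.disjoint_left.2 fun μ hμ hμ' => ?_
    rw [← spectrum.neg_eq, Set.mem_neg] at hμ'
    have hneg := hM (-μ) hμ'
    rw [Complex.neg_re] at hneg
    linarith [hM.transpose μ hμ]
  have hmap : X.map (algebraMap ℝ ℂ) = 0 := by
    refine eq_zero_of_mul_eq_mul_of_disjoint_spectrum hdisj ?_
    rw [Matrix.mul_neg, ← Matrix.map_mul, ← Matrix.map_mul, eq_neg_iff_add_eq_zero,
      ← Matrix.map_add _ (map_add _), hX, Matrix.map_zero _ (map_zero _)]
  exact Matrix.map_injective (algebraMap ℝ ℂ).injective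
    (hmap.trans (Matrix.map_zero _ (map_zero _)).symm)

attribute [local instance] Matrix.normedAddCommGroup Matrix.normedSpace

/-- The Lyapunov operator `X ↦ Mᵀ X + X M`. It acts on the functions underlying matrices, so that
the space of continuous linear operators carries its usual norm. -/
noncomputable def lyapunovOperator (M : Matrix (Fin n) (Fin n) ℝ) :
    (Fin n → Fin n → ℝ) →L[ℝ] (Fin n → Fin n → ℝ) :=
  LinearMap.toContinuousLinearMap (E := Fin n → Fin n → ℝ) (F' := Fin n → Fin n → ℝ)
    (LinearMap.mulLeft ℝ Mᵀ + LinearMap.mulRight ℝ M)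

theorem isLinearMap_lyapunovOperator : IsLinearMap ℝ (lyapunovOperator (n := n)) where
  map_add M N := ContinuousLinearMap.ext fun (X : Matrix (Fin n) (Fin n) ℝ) => by
    change (M + N)ᵀ * X + X * (M + N) = (Mᵀ * X + X * M) + (Nᵀ * X + X * N)
    rw [Matrix.transpose_add, Matrix.add_mul, Matrix.mul_add, add_add_add_comm]
  map_smul c M := ContinuousLinearMap.ext fun (X : Matrix (Fin n) (Fin n) ℝ) => by
    change (c • M)ᵀ * X + X * (c • M) = c • (Mᵀ * X + X * M)
    rw [Matrix.transpose_smul, Matrix.smul_mul, Matrix.mul_smul, smul_add]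

theorem contDiff_lyapunovOperator {k : ℕ∞ω} : ContDiff ℝ k (lyapunovOperator (n := n)) :=
  (LinearMap.toContinuousLinearMap (isLinearMap_lyapunovOperator (n := n)).mk').contDiff

theorem IsHurwitz.isInvertible_lyapunovOperator (hM : IsHurwitz M) :
    (lyapunovOperator M).IsInvertible := by
  have hinj : Function.Injective (lyapunovOperator M).toLinearMap :=
    (injective_iff_map_eq_zero _).2 fun X hX => hM.eq_zero_of_lyapunov hX
  exact ⟨(LinearEquiv.ofInjectiveEndo _ hinj).toContinuousLinearEquiv,
    ContinuousLinearMap.ext fun _ => rfl⟩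

theorem lyapunovSolution_eq_inverse (hM : (lyapunovOperator M).IsInvertible)
    (W : Matrix (Fin n) (Fin n) ℝ) :
    lyapunovSolution M W = (lyapunovOperator M).inverse (-W) := by
  obtain ⟨X, hX⟩ := hM.surjective (-W)
  have hspec : Mᵀ * lyapunovSolution M W + lyapunovSolution M W * M + W = 0 :=
    Classical.epsilon_spec (p := fun X : Matrix (Fin n) (Fin n) ℝ => Mᵀ * X + X * M + W = 0)
      ⟨X, eq_neg_iff_add_eq_zero.1 hX⟩
  exact (hM.inverse_apply_eq.2 (eq_neg_iff_add_eq_zero.2 hspec).symm).symm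

variable {F : Type*} [NormedAddCommGroup F] [NormedSpace ℝ F] {k : ℕ∞ω} {q : F}

theorem contDiffAt_matrix_mul {ι κ ν : Type*} [Fintype ι] [Fintype κ] [Fintype ν]
    {f : F → Matrix ι κ ℝ} {g : F → Matrix κ ν ℝ} (hf : ContDiffAt ℝ k f q)
    (hg : ContDiffAt ℝ k g q) : ContDiffAt ℝ k (fun r => f r * g r) q :=
  contDiffAt_pi.2 fun i => contDiffAt_pi.2 fun j => ContDiffAt.sum fun a _ =>
    (contDiffAt_pi.1 (contDiffAt_pi.1 hf i) a).mul (contDiffAt_pi.1 (contDiffAt_pi.1 hg a) j)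

theorem contDiffAt_matrix_transpose {ι κ : Type*} [Fintype ι] [Fintype κ] {f : F → Matrix ι κ ℝ}
    (hf : ContDiffAt ℝ k f q) : ContDiffAt ℝ k (fun r => (f r)ᵀ) q :=
  contDiffAt_pi.2 fun j => contDiffAt_pi.2 fun i => contDiffAt_pi.1 (contDiffAt_pi.1 hf i) j

theorem contDiffAt_lyapunovSolution {M W : F → Matrix (Fin n) (Fin n) ℝ}
    (hM : ContDiffAt ℝ k M q) (hW : ContDiffAt ℝ k W q) (hq : IsHurwitz (M q)) :
    ContDiffAt ℝ k (fun r => lyapunovSolution (M r) (W r)) q := by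
  have hinv := hq.isInvertible_lyapunovOperator
  have hopen : ∀ᶠ T in 𝓝 (lyapunovOperator (M q)), T.IsInvertible := by
    obtain ⟨e, he⟩ := hinv
    exact he ▸ e.nhds
  have hΛ : ContDiffAt ℝ k (fun r => lyapunovOperator (M r)) q :=
    contDiff_lyapunovOperator.contDiffAt.comp q hM
  refine ContDiffAt.congr_of_eventuallyEq
    ((hinv.contDiffAt_map_inverse.comp q hΛ).clm_apply hW.neg) ?_
  filter_upwards [hΛ.continuousAt.eventually hopen] with r hr
  exact lyapunovSolution_eq_inverse hr (W r)

theorem contDiffAt_policyGradient {m : ℕ} {A : F → Matrix (Fin n) (Fin n) ℝ}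
    {B : Matrix (Fin n) (Fin m) ℝ} {Q : Matrix (Fin n) (Fin n) ℝ} {R : Matrix (Fin m) (Fin m) ℝ}
    {K : F → Matrix (Fin m) (Fin n) ℝ} (hA : ContDiffAt ℝ k A q) (hK : ContDiffAt ℝ k K q)
    (hq : IsHurwitz (A q - B * K q)) :
    ContDiffAt ℝ k (fun r => policyGradient (A r) B Q R (K r)) q := by
  have hAK : ContDiffAt ℝ k (fun r => A r - B * K r) q :=
    hA.sub (contDiffAt_matrix_mul contDiffAt_const hK)
  have hcost : ContDiffAt ℝ k (fun r => costMatrix (A r) B Q R (K r)) q :=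
    contDiffAt_lyapunovSolution hAK (contDiffAt_const.add (contDiffAt_matrix_mul
      (contDiffAt_matrix_mul (contDiffAt_matrix_transpose hK) contDiffAt_const) hK)) hq
  have hgram : ContDiffAt ℝ k (fun r => gramMatrix (A r) B (K r)) q :=
    contDiffAt_lyapunovSolution (contDiffAt_matrix_transpose hAK) contDiffAt_const hq.transpose
  exact (contDiffAt_const (c := (2 : ℝ))).smul (contDiffAt_matrix_mul
    ((contDiffAt_matrix_mul (contDiffAt_const (c := R)) hK).sub
      (contDiffAt_matrix_mul (contDiffAt_const (c := Bᵀ)) hcost)) hgram)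

end Lyapunov

theorem aestronglyMeasurable_comp_of_continuousOn {Ω X Y : Type*} [MeasurableSpace Ω]
    [TopologicalSpace X] [MeasurableSpace X] [OpensMeasurableSpace X] [TopologicalSpace Y]
    [TopologicalSpace.PseudoMetrizableSpace Y] [SecondCountableTopologyEither X Y] {f : X → Y}
    {S : Set X} {q : Ω → X} {μ : Measure Ω} (hf : ContinuousOn f S) (hS : MeasurableSet S)
    (hq : AEMeasurable q μ) (hqS : ∀ᵐ a ∂μ, q a ∈ S) :
    AEStronglyMeasurable (fun a => f (q a)) μ := by
  refine AEStronglyMeasurable.comp_aemeasurable ?_ hq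
  rw [← Measure.restrict_eq_self_of_ae_mem ((ae_map_iff hq hS).2 hqS)]
  exact hf.aestronglyMeasurable hS

theorem aemeasurable_of_mem_piecewiseContinuousTrajectories {X : Type*} [TopologicalSpace X]
    [MeasurableSpace X] [BorelSpace X] {S : Set X} {ρ : ℝ → X}
    (hρ : ρ ∈ piecewiseContinuousTrajectories S) : AEMeasurable ρ (volume.restrict (Ici 0)) := by
  have hcont : ContinuousOn ρ (Ici 0 \ discontinuities ρ) := fun t ht =>
    (not_not.1 fun h => ht.2 ⟨ht.1, h⟩ : ContinuousWithinAt ρ (Ici 0) t).mono sdiff_subset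
  rw [← Measure.restrict_congr_set (sdiff_null_ae_eq_self (hρ.2.measure_zero volume))]
  exact hcont.aemeasurable (measurableSet_Ici.diff hρ.2.measurableSet)

section Field

variable {n m : ℕ} {A : Matrix (Fin n) (Fin n) ℝ} {B : Matrix (Fin n) (Fin m) ℝ}
  {Q : Matrix (Fin n) (Fin n) ℝ} {R : Matrix (Fin m) (Fin m) ℝ} {l u x : Fin n × Fin m → ℝ}
  {α : ℝ} {i : Fin n × Fin m}

/-- The gain whose vectorization is `x`. -/
def gainOfVec (x : Fin n × Fin m → ℝ) : Matrix (Fin m) (Fin n) ℝ :=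
  Matrix.of fun i j => x (j, i)

theorem vec_gainOfVec (x : Fin n × Fin m → ℝ) : (gainOfVec x).vec = x := rfl

theorem gainOfVec_vec (K : Matrix (Fin m) (Fin n) ℝ) : gainOfVec K.vec = K := rfl

/-- The right-hand side of the controller equation of the frozen system `(A, B)`, as a vector field
on vectorized gains. -/
noncomputable def controllerField (A : Matrix (Fin n) (Fin n) ℝ) (B : Matrix (Fin n) (Fin m) ℝ)
    (Q : Matrix (Fin n) (Fin n) ℝ) (R : Matrix (Fin m) (Fin m) ℝ) (l u : Fin n × Fin m → ℝ)
    (α : ℝ) (x : Fin n × Fin m → ℝ) : Fin n × Fin m → ℝ :=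
  -α • projectedGradient A B Q R l u (gainOfVec x)

theorem controllerField_apply (hlu : ∀ i, l i < u i) (hx : x ∈ hyperrectangle l u) :
    controllerField A B Q R l u α x i =
      -α * (facetWeight (x i - l i) (u i - x i) *
        (policyGradient A B Q R (gainOfVec x)).vec i) := by
  have hM : projectionMatrix (boxConstraint l u) x =
      Matrix.diagonal fun i => facetWeight (x i - l i) (u i - x i) :=
    projectionMatrix_boxConstraint fun j => by
      have hl := sub_nonneg.2 (hx j (mem_univ j)).1
      have hu := sub_nonneg.2 (hx j (mem_univ j)).2
      have := mul_nonneg hl hu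
      linarith [hlu j]
  rw [controllerField, projectedGradient, vec_gainOfVec, hM, Pi.smul_apply, Matrix.mulVec_diagonal,
    smul_eq_mul]

attribute [local instance] Matrix.normedAddCommGroup Matrix.normedSpace

variable {S : Set (Matrix (Fin n) (Fin n) ℝ)} {k : ℕ∞ω}
  {q : Matrix (Fin n) (Fin n) ℝ × (Fin n × Fin m → ℝ)}

theorem contDiffAt_vec_policyGradient (hq : IsHurwitz (q.1 - B * gainOfVec q.2)) :
    ContDiffAt ℝ k (fun r : Matrix (Fin n) (Fin n) ℝ × (Fin n × Fin m → ℝ) =>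
      (policyGradient r.1 B Q R (gainOfVec r.2)).vec) q := by
  have hgain : ContDiffAt ℝ k
      (fun r : Matrix (Fin n) (Fin n) ℝ × (Fin n × Fin m → ℝ) => gainOfVec r.2) q :=
    contDiffAt_pi.2 fun i => contDiffAt_pi.2 fun j => by
      change ContDiffAt ℝ k (fun r : Matrix (Fin n) (Fin n) ℝ × (Fin n × Fin m → ℝ) => r.2 (j, i)) q
      fun_prop
  have hgrad := contDiffAt_policyGradient (Q := Q) (R := R) contDiffAt_fst hgain hq
  exact contDiffAt_pi.2 fun i => contDiffAt_pi.1 (contDiffAt_pi.1 hgrad i.2) i.1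

theorem contDiffAt_facetWeight {E : Type*} [NormedAddCommGroup E] [NormedSpace ℝ E] {a b : E → ℝ}
    {y : E} (ha : ContDiffAt ℝ k a y) (hb : ContDiffAt ℝ k b y) (hay : 0 ≤ a y) (hby : 0 ≤ b y)
    (hab : 0 < a y + b y) : ContDiffAt ℝ k (fun z => facetWeight (a z) (b z)) y := by
  simp only [facetWeight]
  exact ((contDiffAt_const.mul ha).mul hb).div
    (((contDiffAt_const.mul ha).mul hb).add (ha.add hb)) (by positivity)

theorem exists_lipschitzOnWith_of_contDiffAt {E F : Type*} [NormedAddCommGroup E] [NormedSpace ℝ E]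
    [NormedAddCommGroup F] [NormedSpace ℝ F] {f : E → F} {s : Set E} (hs : IsCompact s)
    (hf : ∀ y ∈ s, ContDiffAt ℝ 1 f y) : ∃ L, LipschitzOnWith L f s :=
  LocallyLipschitzOn.exists_lipschitzOnWith_of_compact hs fun y hy =>
    (hf y hy).exists_lipschitzOnWith.imp fun _ ⟨t, ht, hL⟩ => ⟨t, nhdsWithin_le_nhds ht, hL⟩

theorem exists_lipschitzOnWith_controllerField (hS : IsCompact S) (hlu : ∀ i, l i < u i)
    (hstab : ∀ A ∈ S, ∀ x ∈ hyperrectangle l u, IsHurwitz (A - B * gainOfVec x)) :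
    ∃ L, LipschitzOnWith L (fun q : Matrix (Fin n) (Fin n) ℝ × (Fin n × Fin m → ℝ) =>
      controllerField q.1 B Q R l u α q.2) (S ×ˢ hyperrectangle l u) := by
  set f : Matrix (Fin n) (Fin n) ℝ × (Fin n × Fin m → ℝ) → Fin n × Fin m → ℝ := fun q i =>
    -α * (facetWeight (q.2 i - l i) (u i - q.2 i) *
      (policyGradient q.1 B Q R (gainOfVec q.2)).vec i)
  have hf : ∀ q ∈ S ×ˢ hyperrectangle l u, controllerField q.1 B Q R l u α q.2 = f q :=
    fun q hq => funext fun i => controllerField_apply hlu hq.2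
  obtain ⟨L, hL⟩ := exists_lipschitzOnWith_of_contDiffAt (f := f)
    (hS.prod (isCompact_hyperrectangle l u)) fun q hq => contDiffAt_pi.2 fun i =>
      contDiffAt_const.mul <| ContDiffAt.mul
        (contDiffAt_facetWeight (by fun_prop) (by fun_prop) (sub_nonneg.2 (hq.2 i (mem_univ i)).1)
          (sub_nonneg.2 (hq.2 i (mem_univ i)).2) (by linarith [hlu i]))
        (contDiffAt_pi.1 (contDiffAt_vec_policyGradient (hstab q.1 hq.1 q.2 hq.2)) i)
  exact ⟨L, fun q hq r hr => (congrArg₂ edist (hf q hq) (hf r hr)).trans_le (hL hq hr)⟩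

theorem exists_bound_policyGradient (hS : IsCompact S)
    (hstab : ∀ A ∈ S, ∀ x ∈ hyperrectangle l u, IsHurwitz (A - B * gainOfVec x)) :
    ∃ C : ℝ≥0, ∀ A ∈ S, ∀ x ∈ hyperrectangle l u, ∀ i,
      |(policyGradient A B Q R (gainOfVec x)).vec i| ≤ C := by
  obtain ⟨C, hC⟩ := (hS.prod (isCompact_hyperrectangle l u)).exists_bound_of_continuousOn
    fun q hq => (contDiffAt_vec_policyGradient (k := 0) (Q := Q) (R := R)
      (hstab q.1 hq.1 q.2 hq.2)).continuousAt.continuousWithinAt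
  exact ⟨C.toNNReal, fun A hA x hx i => (norm_le_pi_norm _ i).trans
    ((hC (A, x) ⟨hA, hx⟩).trans (Real.le_coe_toNNReal C))⟩

theorem abs_controllerField_le (hlu : ∀ i, l i < u i) (hx : x ∈ hyperrectangle l u) {C : ℝ}
    (hC : |(policyGradient A B Q R (gainOfVec x)).vec i| ≤ C) :
    |controllerField A B Q R l u α x i| ≤ 2 * |α| * C * min (x i - l i) (u i - x i) := by
  have hl : 0 ≤ x i - l i := sub_nonneg.2 (hx i (mem_univ i)).1
  have hu : 0 ≤ u i - x i := sub_nonneg.2 (hx i (mem_univ i)).2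
  have hw := facetWeight_nonneg hl hu
  have hmin : facetWeight (x i - l i) (u i - x i) ≤ 2 * min (x i - l i) (u i - x i) := by
    rw [mul_min_of_nonneg _ _ zero_le_two]
    exact le_min (facetWeight_le_left hl hu) (facetWeight_le_right hl hu)
  calc |controllerField A B Q R l u α x i|
      = |α| * (facetWeight (x i - l i) (u i - x i) *
          |(policyGradient A B Q R (gainOfVec x)).vec i|) := by
        rw [controllerField_apply hlu hx, abs_mul, abs_neg, abs_mul, abs_of_nonneg hw]
    _ ≤ |α| * (2 * min (x i - l i) (u i - x i) * C) := by gcongr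
    _ = 2 * |α| * C * min (x i - l i) (u i - x i) := by ring

end Field

section Controller

variable {n m p : ℕ} {A : (Fin p → ℝ) → Matrix (Fin n) (Fin n) ℝ} {B : Matrix (Fin n) (Fin m) ℝ}
  {Q : Matrix (Fin n) (Fin n) ℝ} {R : Matrix (Fin m) (Fin m) ℝ} {l u : Fin n × Fin m → ℝ} {α : ℝ}
  {P : Set (Fin p → ℝ)} {ρ : ℝ → Fin p → ℝ} {J : Set ℝ}

attribute [local instance] Matrix.normedAddCommGroup Matrix.normedSpace

theorem isControllerTrajectory_iff (hα : α ≠ 0) {K : ℝ → Matrix (Fin m) (Fin n) ℝ}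
    (h0 : 0 ∈ J) : IsControllerTrajectory A B Q R l u α ρ J K ↔
      (K 0).vec ∈ interior (hyperrectangle l u) ∧ IsPrimitiveOn (fun t => (K t).vec)
        (fun τ => controllerField (A (ρ τ)) B Q R l u α (K τ).vec) J := by
  have hsub : ∀ t, (K 0).vec - α • ∫ τ in (0 : ℝ)..t, projectedGradient (A (ρ τ)) B Q R l u (K τ) =
      (K 0).vec + ∫ τ in (0 : ℝ)..t, controllerField (A (ρ τ)) B Q R l u α (K τ).vec := fun t => by
    rw [sub_eq_add_neg, ← neg_smul, ← intervalIntegral.integral_smul]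
    rfl
  constructor
  · intro hK
    exact ⟨hK.initial, .of_basepoint (fun t ht => (hK.integrable t ht).smul (-α))
      fun t ht => (hK.equation t ht).trans (hsub t)⟩
  · rintro ⟨hK0, hK⟩
    refine ⟨hK0, fun t ht => ?_, fun t ht => ?_⟩
    · simpa only [controllerField, gainOfVec_vec, Pi.smul_def, inv_smul_smul₀ (neg_ne_zero.2 hα)]
        using (hK.intervalIntegrable 0 h0 t ht).smul (-α)⁻¹
    · rw [hsub, hK.integral_eq_sub 0 h0 t ht, add_sub_cancel]

theorem isHurwitz_of_subset_commonStableGains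
    (hC : hyperrectangle l u ⊆ Matrix.vec '' commonStableGains A B P) :
    ∀ M ∈ A '' P, ∀ x ∈ hyperrectangle l u, IsHurwitz (M - B * gainOfVec x) := by
  rintro _ ⟨ρ, hρ, rfl⟩ x hx
  obtain ⟨K, hK, rfl⟩ := hC hx
  exact mem_iInter₂.1 hK ρ hρ

theorem continuousOn_controllerField (hA : ContinuousOn A P) (hP : IsCompact P)
    (hC : hyperrectangle l u ⊆ Matrix.vec '' commonStableGains A B P) (hlu : ∀ i, l i < u i) :
    ContinuousOn (fun q : (Fin p → ℝ) × (Fin n × Fin m → ℝ) =>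
      controllerField (A q.1) B Q R l u α q.2) (P ×ˢ hyperrectangle l u) := by
  obtain ⟨L, hL⟩ := exists_lipschitzOnWith_controllerField (Q := Q) (R := R) (α := α)
    (hP.image_of_continuousOn hA) hlu (isHurwitz_of_subset_commonStableGains hC)
  exact hL.continuousOn.comp (f := fun q : (Fin p → ℝ) × (Fin n × Fin m → ℝ) => (A q.1, q.2))
    ((hA.comp continuousOn_fst fun _ hq => hq.1).prodMk continuousOn_snd)
    fun _ hq => ⟨mem_image_of_mem A hq.1, hq.2⟩

theorem exists_isBarrierField_controllerField (hA : ContinuousOn A P) (hP : IsCompact P)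
    (hC : hyperrectangle l u ⊆ Matrix.vec '' commonStableGains A B P) (hlu : ∀ i, l i < u i) :
    ∃ L c : ℝ≥0, ∀ ρ : ℝ → Fin p → ℝ, (∀ t, 0 ≤ t → ρ t ∈ P) →
      AEMeasurable ρ (volume.restrict (Ici 0)) →
      IsBarrierField l u L c fun τ => controllerField (A (ρ τ)) B Q R l u α := by
  have hcomp := hP.image_of_continuousOn hA
  have hstab := isHurwitz_of_subset_commonStableGains hC
  obtain ⟨L, hL⟩ := exists_lipschitzOnWith_controllerField (Q := Q) (R := R) (α := α)
    hcomp hlu hstab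
  obtain ⟨C, hgrad⟩ := exists_bound_policyGradient (Q := Q) (R := R) hcomp hstab
  refine ⟨L, 2 * ‖α‖₊ * C, fun ρ hρ hmeas => ?_⟩
  have hbound : ∀ τ, 0 ≤ τ → ∀ x ∈ hyperrectangle l u, ∀ i,
      |controllerField (A (ρ τ)) B Q R l u α x i| ≤
        ↑(2 * ‖α‖₊ * C) * min (x i - l i) (u i - x i) := fun τ hτ x hx i =>
    abs_controllerField_le hlu hx (hgrad _ (mem_image_of_mem A (hρ τ hτ)) x hx i)
  refine ⟨fun τ hτ => ?_, fun τ hτ x hx i => (hbound τ hτ x hx i).trans ?_,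
    fun τ hτ x hx i => (hbound τ hτ x hx i).trans ?_, fun x hx hxC => ?_⟩
  · exact LipschitzOnWith.of_dist_le_mul fun x hx y hy =>
      (hL.dist_le_mul (A (ρ τ), x) ⟨mem_image_of_mem A (hρ τ hτ), hx⟩ (A (ρ τ), y)
        ⟨mem_image_of_mem A (hρ τ hτ), hy⟩).trans_eq (by rw [dist_prod_same_left])
  · gcongr
    exact min_le_left _ _
  · gcongr
    exact min_le_right _ _
  · exact aestronglyMeasurable_comp_of_continuousOn (q := fun τ => (ρ τ, x τ))
      (continuousOn_controllerField hA hP hC hlu)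
      (hP.prod (isCompact_hyperrectangle l u)).measurableSet (hmeas.prodMk hx.aemeasurable)
      (ae_restrict_of_forall_mem measurableSet_Ici fun τ hτ => ⟨hρ τ hτ, hxC τ⟩)

theorem exists_unique_isControllerTrajectory {L c : ℝ≥0}
    (hbar : IsBarrierField l u L c fun τ => controllerField (A (ρ τ)) B Q R l u α) (hα : α ≠ 0)
    {K₀ : Matrix (Fin m) (Fin n) ℝ} (hK₀ : K₀.vec ∈ interior (hyperrectangle l u)) :
    ∃ K : ℝ → Matrix (Fin m) (Fin n) ℝ, K 0 = K₀ ∧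
      IsControllerTrajectory A B Q R l u α ρ (Ici 0) K ∧
      ∀ (J : Set ℝ) (K' : ℝ → Matrix (Fin m) (Fin n) ℝ), J ⊆ Ici 0 → 0 ∈ J → J.OrdConnected →
        K' 0 = K₀ → IsControllerTrajectory A B Q R l u α ρ J K' → EqOn K' K J := by
  obtain ⟨x, hx0, hxint, hx⟩ := hbar.exists_isPrimitiveOn hK₀
  refine ⟨fun t => gainOfVec (x t), (congrArg gainOfVec hx0).trans (gainOfVec_vec K₀),
    (isControllerTrajectory_iff hα self_mem_Ici).2 ⟨hxint 0 self_mem_Ici, hx⟩,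
    fun J K' hJ h0 hconn hK'0 hK' => ?_⟩
  have heq := (hx.mono hJ).eqOn_of_lipschitzOnWith (fun t ht => hbar.lipschitzOnWith t (hJ ht))
    ((isControllerTrajectory_iff hα h0).1 hK').2 (fun t ht => hxint t (hJ ht)) hconn h0
    (by rw [hK'0, hx0])
  exact fun t ht => congrArg gainOfVec (heq ht)

theorem IsControllerTrajectory.mem_rateBoundedTrajectories {L c : ℝ≥0}
    {K : ℝ → Matrix (Fin m) (Fin n) ℝ} (hK : IsControllerTrajectory A B Q R l u α ρ (Ici 0) K)
    (hbar : IsBarrierField l u L c fun τ => controllerField (A (ρ τ)) B Q R l u α) (hα : α ≠ 0)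
    (hcont : ContinuousOn (fun q : (Fin p → ℝ) × (Fin n × Fin m → ℝ) =>
      controllerField (A q.1) B Q R l u α q.2) (P ×ˢ hyperrectangle l u))
    (hρ : ∀ t, 0 ≤ t → ρ t ∈ P) :
    (fun t => (K t).vec) ∈ rateBoundedTrajectories (hyperrectangle l u)
      (hyperrectangle (-((c : ℝ) • (u - l))) ((c : ℝ) • (u - l))) (discontinuities ρ) := by
  obtain ⟨hK0, hprim⟩ := (isControllerTrajectory_iff hα self_mem_Ici).1 hK
  have hmem : ∀ t, 0 ≤ t → (K t).vec ∈ hyperrectangle l u :=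
    fun t ht => interior_subset (hbar.mem_interior hprim hK0 ht)
  refine ⟨hmem, hprim.continuousOn, fun t ht htD => ⟨_, fun i _ => ?_,
    hprim.hasDerivWithinAt ordConnected_Ici ht ?_⟩⟩
  · exact abs_le.1 (hbar.abs_le ht (hmem t ht) i)
  · have hρt : ContinuousWithinAt ρ (Ici 0) t := not_not.1 fun h => htD ⟨ht, h⟩
    have hpair : ContinuousWithinAt (fun τ => (ρ τ, (K τ).vec)) (Ici 0) t :=
      hρt.prodMk (hprim.continuousOn t ht)
    exact (hcont (ρ t, (K t).vec) ⟨hρ t ht, hmem t ht⟩).comp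
      (f := fun τ => (ρ τ, (K τ).vec)) hpair fun τ hτ => ⟨hρ τ hτ, hmem τ hτ⟩

theorem continuous_affineFamily (A₀ : Matrix (Fin n) (Fin n) ℝ)
    (A₁ : Fin p → Matrix (Fin n) (Fin n) ℝ) : Continuous (affineFamily A₀ A₁) := by
  unfold affineFamily
  fun_prop

end Controller

end ProjectedLQR

open ProjectedLQR in
theorem mainTheorem5_general {n m p : ℕ} {A : (Fin p → ℝ) → Matrix (Fin n) (Fin n) ℝ}
    (B : Matrix (Fin n) (Fin m) ℝ) (Q : Matrix (Fin n) (Fin n) ℝ) (R : Matrix (Fin m) (Fin m) ℝ)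
    {P : Set (Fin p → ℝ)} (hA : ContinuousOn A P) (hP : IsCompact P) (l u : Fin n × Fin m → ℝ)
    {α : ℝ} (hα : α ≠ 0) (hC : hyperrectangle l u ⊆ Matrix.vec '' commonStableGains A B P) :
    ∃ V : Set (Fin n × Fin m → ℝ), IsPolytope V ∧ 0 ∈ V ∧
      ∀ ρ : ℝ → Fin p → ℝ, (∀ t, 0 ≤ t → ρ t ∈ P) → AEMeasurable ρ (volume.restrict (Ici 0)) →
        (∀ K₀ : Matrix (Fin m) (Fin n) ℝ, K₀.vec ∈ interior (hyperrectangle l u) →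
          ∃ K : ℝ → Matrix (Fin m) (Fin n) ℝ, K 0 = K₀ ∧
            IsControllerTrajectory A B Q R l u α ρ (Ici 0) K ∧
            ∀ (J : Set ℝ) (K' : ℝ → Matrix (Fin m) (Fin n) ℝ), J ⊆ Ici 0 → 0 ∈ J →
              J.OrdConnected → K' 0 = K₀ → IsControllerTrajectory A B Q R l u α ρ J K' →
              EqOn K' K J) ∧
        ∀ K : ℝ → Matrix (Fin m) (Fin n) ℝ, IsControllerTrajectory A B Q R l u α ρ (Ici 0) K →
          (∀ t : ℝ, 0 ≤ t → (K t).vec ∈ interior (hyperrectangle l u)) ∧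
          (fun t => (K t).vec) ∈
            rateBoundedTrajectories (hyperrectangle l u) V (discontinuities ρ) := by
  by_cases hlu : ∀ i, l i < u i
  · obtain ⟨L, c, hbar⟩ :=
      exists_isBarrierField_controllerField (Q := Q) (R := R) (α := α) hA hP hC hlu
    have hwidth : 0 ≤ (c : ℝ) • (u - l) :=
      smul_nonneg c.2 (sub_nonneg.2 fun i => (hlu i).le)
    refine ⟨hyperrectangle (-((c : ℝ) • (u - l))) ((c : ℝ) • (u - l)),
      isPolytope_hyperrectangle (neg_le_self hwidth),
      fun i _ => ⟨neg_nonpos.2 (hwidth i), hwidth i⟩, fun ρ hρ hmeas => ⟨fun K₀ hK₀ =>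
        exists_unique_isControllerTrajectory (hbar ρ hρ hmeas) hα hK₀, fun K hK => ⟨?_, ?_⟩⟩⟩
    · obtain ⟨hK0, hprim⟩ := (isControllerTrajectory_iff hα self_mem_Ici).1 hK
      exact fun t ht => (hbar ρ hρ hmeas).mem_interior hprim hK0 ht
    · exact hK.mem_rateBoundedTrajectories (hbar ρ hρ hmeas) hα
        (continuousOn_controllerField hA hP hC hlu) hρ
  · have hempty : ∀ x, x ∉ interior (hyperrectangle l u) := fun x hx => hlu fun i =>
      ((mem_interior_hyperrectangle.1 hx i).1.trans (mem_interior_hyperrectangle.1 hx i).2)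
    exact ⟨{0}, ⟨{0}, finite_singleton 0, (convexHull_singleton 0).symm⟩, rfl, fun ρ _ _ =>
      ⟨fun K₀ hK₀ => absurd hK₀ (hempty _), fun K hK => absurd hK.initial (hempty _)⟩⟩

theorem mainTheorem5 {n m p : ℕ}
    (A₀ : Matrix (Fin n) (Fin n) ℝ) (A₁ : Fin p → Matrix (Fin n) (Fin n) ℝ)
    (B : Matrix (Fin n) (Fin m) ℝ)
    (Q : Matrix (Fin n) (Fin n) ℝ) (hQ : Q.PosSemidef)
    (R : Matrix (Fin m) (Fin m) ℝ) (hR : R.PosDef)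
    (P : Set (Fin p → ℝ)) (hP : ProjectedLQR.IsPolytope P)
    (l u : Fin n × Fin m → ℝ) (α : ℝ) (hα : 0 < α)
    (hC : ProjectedLQR.hyperrectangle l u ⊆
      Matrix.vec '' ProjectedLQR.commonStableGains (ProjectedLQR.affineFamily A₀ A₁) B P) :
    ∃ V : Set (Fin n × Fin m → ℝ), ProjectedLQR.IsPolytope V ∧ 0 ∈ V ∧
      ∀ ρ ∈ ProjectedLQR.piecewiseContinuousTrajectories P,
        -- from every admissible initial gain there is exactly one trajectory, defined for all time
        (∀ K₀ : Matrix (Fin m) (Fin n) ℝ,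
          K₀.vec ∈ interior (ProjectedLQR.hyperrectangle l u) →
          ∃ K : ℝ → Matrix (Fin m) (Fin n) ℝ, K 0 = K₀ ∧
            ProjectedLQR.IsControllerTrajectory (ProjectedLQR.affineFamily A₀ A₁) B Q R l u α ρ
              (Set.Ici 0) K ∧
            ∀ (J : Set ℝ) (K' : ℝ → Matrix (Fin m) (Fin n) ℝ),
              J ⊆ Set.Ici 0 → 0 ∈ J → J.OrdConnected → K' 0 = K₀ →
              ProjectedLQR.IsControllerTrajectory (ProjectedLQR.affineFamily A₀ A₁) B Q R l u α ρ
                J K' → Set.EqOn K' K J) ∧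
        -- every trajectory stays in the interior of the hyperrectangle and is continuous, with
        -- derivative in `V` wherever `ρ` is continuous
        ∀ K : ℝ → Matrix (Fin m) (Fin n) ℝ,
          ProjectedLQR.IsControllerTrajectory (ProjectedLQR.affineFamily A₀ A₁) B Q R l u α ρ
            (Set.Ici 0) K →
          (∀ t : ℝ, 0 ≤ t → (K t).vec ∈ interior (ProjectedLQR.hyperrectangle l u)) ∧
          (fun t => (K t).vec) ∈ ProjectedLQR.rateBoundedTrajectories
            (ProjectedLQR.hyperrectangle l u) V (ProjectedLQR.discontinuities ρ) := by
  obtain ⟨V, hV, h0, hmain⟩ := mainTheorem5_general B Q R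
    (ProjectedLQR.continuous_affineFamily A₀ A₁).continuousOn hP.isCompact l u hα.ne' hC
  exact ⟨V, hV, h0, fun ρ hρ =>
    hmain ρ hρ.1 (ProjectedLQR.aemeasurable_of_mem_piecewiseContinuousTrajectories hρ)⟩
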